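/- Let $c_i>0$, $p_i\in(0,1)$, $\mu>0$, $t>0$. Let $(M_s)_{s\ge 0}$ be a homogeneous Poisson process with intensity $p_i\mu$ (the counting process of arrivals with i.i.d. exponential interarrival times of rate $p_i\mu$), let $W_1,W_2,\dots$ be i.i.d. positive random variables, and let $T$ be exponentially distributed with mean $t$, where $(M_s)$, $(W_k)$ and $T$ are independent. Suppose that $W_k$ has as density a combination of exponentials $$f_W(w)=\sum_{j=1}^n A_j\alpha_j e^{-\alpha_j w},\qquad w>0,$$ where $0<\alpha_1<\dots<\alpha_n$, the $A_j$ are real (not necessarily positive) with $A_1+\dots+A_n=1$, and $f_W\ge 0$. For $u>0$ consider the surplus of an individual pay-per-share miner $$R_s=u-c_i s+\sum_{k=1}^{M_s}W_k,\quad s\ge 0,\qquad \tau=\inf\{s\ge 0: R_s<0\},\qquad \hat V(u,t)=\mathbb E\big(R_T\,\mathbb 1_{\{\tau>T\}}\big).$$ Then the equation $$c_i z+p_i\mu\sum_{j=1}^n\frac{A_j\alpha_j}{z+\alpha_j}-\Big(\frac1t+p_i\mu\Big)=0$$ has exactly one solution $z=R$ in the half-plane $\{z\in\mathbb C:\operatorname{Re}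 z>0\}$, this solution is real, and for every $u>0$ the variable $R_T\,\mathbb 1_{\{\tau>T\}}$ is integrable and $$\hat V(u,t)=t\Big(c_i-p_i\mu\sum_{j=1}^n\frac{A_j}{\alpha_j}\Big)e^{-Ru}+u+t\Big(p_i\mu\sum_{j=1}^n\frac{A_j}{\alpha_j}-c_i\Big).$$ -/

import Mathlib

open MeasureTheory ProbabilityTheory

/-- The function `w ↦ ∑ j, A j * α j * exp (-α j * w)` on `w > 0`, extended by `0` to `w ≤ 0`. -/
noncomputable def combExpDensity {n : ℕ} (A α : Fin n → ℝ) (w : ℝ) : ℝ :=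
  if 0 < w then ∑ j, A j * α j * Real.exp (-α j * w) else 0

/-- The coefficients `A` (of arbitrary sign) and the rates `α` define a combination of exponentials:
the rates are positive and increasing, the coefficients sum to one, and the resulting function is
nonnegative, so that it is a probability density on the positive half-line. -/
structure IsCombExp {n : ℕ} (A α : Fin n → ℝ) : Prop where
  rate_pos : ∀ j, 0 < α j
  rate_strictMono : StrictMono α
  sum_coeff : ∑ j, A j = 1
  nonneg : ∀ w, 0 < w → 0 ≤ ∑ j, A j * α j * Real.exp (-α j * w)

/-- The time of the `(k + 1)`-st arrival when the interarrival times are `ξ 0, ξ 1, …`. -/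
noncomputable def arrivalTime {Ω : Type*} (ξ : ℕ → Ω → ℝ) (k : ℕ) (ω : Ω) : ℝ :=
  ∑ j ∈ Finset.range (k + 1), ξ j ω

/-- The number of arrivals up to time `s`. For i.i.d. exponential interarrival times of rate `r`
this is the homogeneous Poisson process with intensity `r` (the set below is then almost surely
finite for all `s`). -/
noncomputable def arrivalCount {Ω : Type*} (ξ : ℕ → Ω → ℝ) (s : ℝ) (ω : Ω) : ℕ :=
  {k : ℕ | arrivalTime ξ k ω ≤ s}.ncard

/-- The surplus `u - c s + ∑_{k ≤ M_s} W_k` of a miner with initial capital `u`, cost rate `c`,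
arrival counting process `M` and successive rewards `W 0, W 1, …`. -/
noncomputable def minerSurplus {Ω : Type*} (c : ℝ) (ξ W : ℕ → Ω → ℝ) (u s : ℝ) (ω : Ω) : ℝ :=
  u - c * s + ∑ k ∈ Finset.range (arrivalCount ξ s ω), W k ω

/-- The ruin time `inf {s ≥ 0 : X s < 0}`, equal to `⊤` if the path never becomes negative. -/
noncomputable def ruinTime {Ω : Type*} (X : ℝ → Ω → ℝ) (ω : Ω) : EReal :=
  sInf {x : EReal | ∃ s : ℝ, 0 ≤ s ∧ X s ω < 0 ∧ x = (s : EReal)}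

/-- The random variable `X_T 𝟙_{τ > T}`, where `τ` is the ruin time of `X`. -/
noncomputable def surplusBeforeRuin {Ω : Type*} (X : ℝ → Ω → ℝ) (T : Ω → ℝ) : Ω → ℝ :=
  {ω | (T ω : EReal) < ruinTime X ω}.indicator (fun ω => X (T ω) ω)

/-- The expected surplus `E[R_T 𝟙_{τ > T}]` of the miner at the random horizon `T`. -/
noncomputable def expectedSurplus {Ω : Type*} [MeasurableSpace Ω] (P : Measure Ω)
    (c : ℝ) (ξ W : ℕ → Ω → ℝ) (T : Ω → ℝ) (u : ℝ) : ℝ :=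
  ∫ ω, surplusBeforeRuin (minerSurplus c ξ W u) T ω ∂P

/-! Write r = p μ and δ = 1 / t, let L and m be the Laplace transform and the mean of the reward
law, put B = (c - r m) / δ and v(x) = B (e^{-R x} - 1) + x (`surplusValue`). The claimed value is
v(u). It is not derived by solving an equation for the expectation; instead v is verified along the
arrivals.

Splitting according to whether the horizon or the next arrival comes first, v satisfies a renewal
identity (`surplusValue_eq_integral_add`): the Lundberg equation c R + r L(R) = δ + r balances the
exponential terms, the choice of B balances the constants, and v(0) = 0 removes the boundary term at
ruin. Let S_n be the n-th arrival time and D_n the product of e^{-δ S_n}, the indicator of survival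
until S_n, and v at the surplus just after S_n. Lack of memory turns the renewal identity into: the
event of exactly n arrivals before the horizon contributes E D_n - E D_{n+1}. The sum telescopes to
v(u), since E D_n tends to 0 (`tendsto_integral_discountedValue`). The contributions are
nonnegative, so sum and expectation may be exchanged, and integrability follows from the same sum
(`integral_surplusBeforeRuin`).

The root is treated for any positive integrable reward (`exists_unique_lundberg_root`): the
intermediate value theorem gives R, convexity excludes roots with real part below R, and a Lipschitz
bound with constant less than one excludes the others. Combinations of exponentials enter only
through the explicit L and m. -/

/-! ### Combinations of exponentials: Laplace transform and mean. -/

lemma measurable_combExpDensity {n : ℕ} (A α : Fin n → ℝ) : Measurable (combExpDensity A α) := by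
  unfold combExpDensity
  exact Measurable.ite measurableSet_Ioi (by fun_prop) measurable_const

lemma IsCombExp.density_nonneg {n : ℕ} {A α : Fin n → ℝ} (hA : IsCombExp A α) (w : ℝ) :
    0 ≤ combExpDensity A α w := by
  unfold combExpDensity
  split_ifs with h
  · exact hA.nonneg w h
  · exact le_rfl

/-- The law on the positive half-line whose density is the combination of exponentials. -/
noncomputable def combExpMeasure {n : ℕ} (A α : Fin n → ℝ) : Measure ℝ :=
  volume.withDensity (fun w => ENNReal.ofReal (combExpDensity A α w))

lemma ae_pos_combExpMeasure {n : ℕ} (A α : Fin n → ℝ) : ∀ᵐ w ∂combExpMeasure A α, 0 < w := by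
  unfold combExpMeasure
  rw [ae_withDensity_iff (measurable_combExpDensity A α).ennreal_ofReal]
  refine ae_of_all _ fun w hw => ?_
  by_contra h
  simp [combExpDensity, h] at hw

section

variable {E : Type*} [NormedAddCommGroup E] [NormedSpace ℝ E]

lemma integrable_combExpMeasure_iff {n : ℕ} {A α : Fin n → ℝ} (hA : IsCombExp A α) {g : ℝ → E} :
    Integrable g (combExpMeasure A α) ↔
      IntegrableOn (fun w => (∑ j, A j * α j * Real.exp (-α j * w)) • g w) (Set.Ioi 0) := by
  unfold combExpMeasure
  rw [integrable_withDensity_iff_integrable_smul'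
    (measurable_combExpDensity A α).ennreal_ofReal (by simp),
    ← integrable_indicator_iff measurableSet_Ioi]
  refine integrable_congr (ae_of_all _ fun w => ?_)
  beta_reduce
  rw [ENNReal.toReal_ofReal (hA.density_nonneg w)]
  by_cases h : 0 < w <;> simp [combExpDensity, h]

lemma integral_combExpMeasure {n : ℕ} {A α : Fin n → ℝ} (hA : IsCombExp A α) (g : ℝ → E) :
    ∫ w, g w ∂combExpMeasure A α =
      ∫ w in Set.Ioi 0, (∑ j, A j * α j * Real.exp (-α j * w)) • g w := by
  unfold combExpMeasure
  rw [integral_withDensity_eq_integral_toReal_smul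
    (measurable_combExpDensity A α).ennreal_ofReal (by simp),
    ← integral_indicator measurableSet_Ioi]
  refine integral_congr_ae (ae_of_all _ fun w => ?_)
  beta_reduce
  rw [ENNReal.toReal_ofReal (hA.density_nonneg w)]
  by_cases h : 0 < w <;> simp [combExpDensity, h]

end

/-- The Laplace transform of a combination of exponentials. -/
lemma integral_cexp_combExpMeasure {n : ℕ} {A α : Fin n → ℝ} (hA : IsCombExp A α) {z : ℂ}
    (hz : 0 ≤ z.re) :
    ∫ w, Complex.exp (-z * (w : ℂ)) ∂combExpMeasure A α = ∑ j, (A j : ℂ) * α j / (z + α j) := by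
  rw [integral_combExpMeasure hA]
  have key : ∀ w : ℝ, (∑ j, A j * α j * Real.exp (-α j * w)) • Complex.exp (-z * (w : ℂ)) =
      ∑ j, ((A j : ℂ) * α j) * Complex.exp (-(z + α j) * (w : ℂ)) := by
    intro w
    rw [Complex.real_smul]
    push_cast
    rw [Finset.sum_mul]
    refine Finset.sum_congr rfl fun j _ => ?_
    rw [mul_assoc, ← Complex.exp_add]
    ring_nf
  have hre : ∀ j, (-(z + α j)).re < 0 := fun j => by
    have := hA.rate_pos j
    simp
    linarith
  simp_rw [key]
  rw [integral_finsetSum _ fun j _ => (integrableOn_exp_mul_complex_Ioi (hre j) 0).const_mul _]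
  refine Finset.sum_congr rfl fun j _ => ?_
  rw [integral_const_mul, integral_exp_mul_complex_Ioi (hre j)]
  simp [div_eq_mul_inv, -neg_add_rev, inv_neg]

lemma integrable_id_combExpMeasure {n : ℕ} {A α : Fin n → ℝ} (hA : IsCombExp A α) :
    Integrable (fun w => w) (combExpMeasure A α) := by
  rw [integrable_combExpMeasure_iff hA]
  simp_rw [smul_eq_mul, Finset.sum_mul]
  refine integrable_finsetSum _ fun j _ => ?_
  have := integrableOn_rpow_mul_exp_neg_mul_rpow (p := 1) (s := 1) (by norm_num) one_pos
    (hA.rate_pos j)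
  simp only [Real.rpow_one] at this
  refine (this.const_mul (A j * α j)).congr (ae_of_all _ fun w => ?_)
  dsimp only
  ring

lemma integral_id_combExpMeasure {n : ℕ} {A α : Fin n → ℝ} (hA : IsCombExp A α) :
    ∫ w, w ∂combExpMeasure A α = ∑ j, A j / α j := by
  rw [integral_combExpMeasure hA]
  have hi : ∀ j, IntegrableOn (fun w : ℝ => w * Real.exp (-α j * w)) (Set.Ioi 0) := fun j => by
    have := integrableOn_rpow_mul_exp_neg_mul_rpow (p := 1) (s := 1) (by norm_num) one_pos
      (hA.rate_pos j)
    simpa only [Real.rpow_one] using this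
  have key : ∀ w : ℝ, (∑ j, A j * α j * Real.exp (-α j * w)) • w =
      ∑ j, (A j * α j) * (w * Real.exp (-α j * w)) := by
    intro w
    rw [smul_eq_mul, Finset.sum_mul]
    exact Finset.sum_congr rfl fun j _ => by ring
  simp_rw [key]
  rw [integral_finsetSum _ fun j _ => (hi j).const_mul _]
  refine Finset.sum_congr rfl fun j _ => ?_
  have hj := hA.rate_pos j
  have h2 := Real.integral_rpow_mul_exp_neg_mul_Ioi (a := 2) (r := α j) (by norm_num) hj
  norm_num at h2
  rw [integral_const_mul]
  simp_rw [neg_mul, h2]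
  field_simp

lemma isCombExp_exponential {r : ℝ} (hr : 0 < r) : IsCombExp ![1] ![r] where
  rate_pos j := by simpa using hr
  rate_strictMono := Subsingleton.strictMono _
  sum_coeff := by simp
  nonneg w _ := by
    simp
    positivity

/-- The two densities differ only at the origin. The case of a single exponential lets the
interarrival times and the horizon reuse the formulas for rewards. -/
lemma expMeasure_eq_combExpMeasure (r : ℝ) : expMeasure r = combExpMeasure ![1] ![r] := by
  unfold combExpMeasure
  change volume.withDensity (exponentialPDF r) = _
  refine withDensity_congr_ae ?_
  filter_upwards [Measure.ae_ne volume (0 : ℝ)] with w hw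
  rw [exponentialPDF_eq]
  rcases lt_or_gt_of_ne hw with h | h
  · simp [combExpDensity, h.not_ge, h.le.not_gt]
  · simp [combExpDensity, h.le, h]

lemma ae_pos_expMeasure (r : ℝ) : ∀ᵐ w ∂expMeasure r, 0 < w := by
  rw [expMeasure_eq_combExpMeasure]
  exact ae_pos_combExpMeasure _ _

lemma integral_expMeasure {r : ℝ} (hr : 0 < r) (g : ℝ → ℝ) :
    ∫ w, g w ∂expMeasure r = ∫ w in Set.Ioi 0, r * Real.exp (-r * w) * g w := by
  rw [expMeasure_eq_combExpMeasure, integral_combExpMeasure (isCombExp_exponential hr)]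
  simp

/-! ### The root of the Lundberg equation. -/

/-- Mean value inequality on the convex left half-plane, where the derivative of exp has norm at
most 1. -/
lemma norm_cexp_sub_one_le_of_re_nonpos {v : ℂ} (hv : v.re ≤ 0) :
    ‖Complex.exp v - 1‖ ≤ ‖v‖ := by
  have h := (convex_halfSpace_re_le 0).norm_image_sub_le_of_norm_hasDerivWithin_le
    (f := Complex.exp) (f' := Complex.exp) (C := 1) (x := 0) (y := v)
    (fun x _ => (Complex.hasDerivAt_exp x).hasDerivWithinAt)
    (fun x hx => by
      rw [Complex.norm_exp]
      exact Real.exp_le_one_iff.2 hx) (by simp) hv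
  simpa using h

lemma integral_cexp_neg_ofReal (ν : Measure ℝ) (x : ℝ) :
    ∫ w : ℝ, Complex.exp (-(x : ℂ) * w) ∂ν = ((∫ w, Real.exp (-x * w) ∂ν : ℝ) : ℂ) := by
  rw [← integral_complex_ofReal]
  simp

section

variable {ν : Measure ℝ} [IsProbabilityMeasure ν]

lemma integrable_exp_neg_mul (hpos : ∀ᵐ w ∂ν, 0 < w) {x : ℝ} (hx : 0 ≤ x) :
    Integrable (fun w => Real.exp (-x * w)) ν := by
  refine Integrable.of_bound (by fun_prop) 1 ?_
  filter_upwards [hpos] with w hw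
  rw [Real.norm_eq_abs, Real.abs_exp, Real.exp_le_one_iff]
  nlinarith

lemma integrable_cexp_neg_mul (hpos : ∀ᵐ w ∂ν, 0 < w) {z : ℂ} (hz : 0 ≤ z.re) :
    Integrable (fun w : ℝ => Complex.exp (-z * w)) ν := by
  refine Integrable.of_bound (by fun_prop) 1 ?_
  filter_upwards [hpos] with w hw
  rw [Complex.norm_exp, Real.exp_le_one_iff]
  simp
  positivity

lemma continuousOn_integral_exp_neg_mul (hpos : ∀ᵐ w ∂ν, 0 < w) :
    ContinuousOn (fun x : ℝ => ∫ w, Real.exp (-x * w) ∂ν) (Set.Ici 0) := by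
  refine continuousOn_of_dominated (bound := fun _ => 1) (fun x _ => by fun_prop) ?_
    (integrable_const _) (ae_of_all _ fun w => by fun_prop)
  intro x hx
  filter_upwards [hpos] with w hw
  rw [Real.norm_eq_abs, Real.abs_exp, Real.exp_le_one_iff]
  have : 0 ≤ x := hx
  nlinarith

/-- The generalized Lundberg equation of a process with downward drift and positive jumps has
exactly one root in the right half-plane, and this root is real. -/
theorem exists_unique_lundberg_root (hpos : ∀ᵐ w ∂ν, 0 < w) (hint : Integrable (fun w => w) ν)
    {c r δ : ℝ} (hc : 0 < c) (hr : 0 < r) (hδ : 0 < δ) :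
    ∃ R : ℝ, 0 < R ∧ c * R + r * ∫ w, Real.exp (-R * w) ∂ν = δ + r ∧
      ∀ z : ℂ, 0 < z.re →
        ((c : ℂ) * z + r * ∫ w : ℝ, Complex.exp (-z * w) ∂ν = δ + r ↔ z = (R : ℂ)) := by
  set L : ℝ → ℝ := fun x => ∫ w, Real.exp (-x * w) ∂ν with hL
  have hL0 : L 0 = 1 := by simp [hL]
  have hLnn : ∀ x, 0 ≤ L x := fun x => integral_nonneg fun w => (Real.exp_pos _).le
  -- At 0 the function equals r, which is below the target; at (δ + r) / c the linear term alone
  -- reaches it.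
  obtain ⟨R, ⟨hR0, -⟩, hR⟩ : δ + r ∈ (fun x => c * x + r * L x) '' Set.Icc 0 ((δ + r) / c) := by
    refine intermediate_value_Icc (by positivity) ?_ ⟨by simp [hL0, hδ.le], ?_⟩
    · exact ((continuous_const_mul c).continuousOn.add (continuousOn_const.mul
        ((continuousOn_integral_exp_neg_mul hpos).mono Set.Icc_subset_Ici_self)))
    · have := hLnn ((δ + r) / c)
      rw [mul_div_cancel₀ _ hc.ne']
      nlinarith
  simp only at hR
  have hRpos : 0 < R := by
    rcases hR0.eq_or_lt with h | h
    · rw [← h, hL0] at hR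
      linarith
    · exact h
  have hmint : Integrable (fun w => w * Real.exp (-R * w)) ν := by
    refine hint.mono (by fun_prop) ?_
    filter_upwards [hpos] with w hw
    rw [norm_mul, Real.norm_eq_abs (Real.exp _), Real.abs_exp]
    have : Real.exp (-R * w) ≤ 1 := Real.exp_le_one_iff.2 (by nlinarith)
    exact mul_le_of_le_one_right (norm_nonneg _) this
  -- D plays the role of -L'(R), and r D < c is strict increase at R. Averaging e^{-R w} (1 + R w) ≤
  -- 1 gives L(R) + R D ≤ 1, so r D ≥ c would force c R + r L(R) ≤ r < δ + r.
  set D : ℝ := ∫ w, w * Real.exp (-R * w) ∂ν with hD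
  have hDlt : r * D < c := by
    have h1 : L R + R * D ≤ 1 := by
      rw [hD, ← integral_const_mul, ← integral_add (integrable_exp_neg_mul hpos hR0)
        (hmint.const_mul _)]
      calc _ ≤ ∫ _, (1 : ℝ) ∂ν := by
            refine integral_mono ((integrable_exp_neg_mul hpos hR0).add (hmint.const_mul _))
              (integrable_const _) fun w => ?_
            have h2 := Real.add_one_le_exp (R * w)
            have h3 : Real.exp (-R * w) * Real.exp (R * w) = 1 := by
              rw [← Real.exp_add]
              simp
            have h4 := Real.exp_pos (-R * w)
            simp only
            nlinarith
        _ = 1 := by simp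
    by_contra! hcon
    have h5 : c * R ≤ r * (R * D) := by nlinarith
    nlinarith
  refine ⟨R, hRpos, hR, fun z hz => ⟨fun hzeq => ?_, ?_⟩⟩
  · have hxL : δ + r ≤ c * z.re + r * L z.re := by
      have h1 := congrArg Complex.re hzeq
      simp only [Complex.add_re, Complex.re_ofReal_mul, Complex.ofReal_re] at h1
      have h2 : (∫ w : ℝ, Complex.exp (-z * w) ∂ν).re ≤ L z.re := by
        refine (Complex.re_le_norm _).trans ((norm_integral_le_integral_norm _).trans_eq ?_)
        refine integral_congr_ae (ae_of_all _ fun w => ?_)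
        simp [Complex.norm_exp]
      nlinarith
    -- On [0, R) the chord bound for the convex L keeps c x + r L(x) strictly below δ + r,
    -- contradicting `hxL`.
    have hRz : R ≤ z.re := by
      by_contra! hlt
      have hconv : L z.re ≤ (1 - z.re / R) + z.re / R * L R := by
        have hθ : z.re / R ≤ 1 := (div_le_one hRpos).2 hlt.le
        have hθ0 : 0 ≤ z.re / R := by positivity
        calc L z.re ≤ ∫ w, ((1 - z.re / R) + z.re / R * Real.exp (-R * w)) ∂ν := by
              refine integral_mono (integrable_exp_neg_mul hpos hz.le) ((integrable_const _).add
                ((integrable_exp_neg_mul hpos hR0).const_mul _)) fun w => ?_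
              have := convexOn_exp.2 (Set.mem_univ 0) (Set.mem_univ (-R * w))
                (sub_nonneg.2 hθ) hθ0 (by ring)
              simp only [smul_eq_mul, mul_zero, zero_add, Real.exp_zero, mul_one] at this
              convert! this using 2
              field_simp
          _ = _ := by
              rw [integral_add (integrable_const _)
                ((integrable_exp_neg_mul hpos hR0).const_mul _), integral_const_mul]
              simp [hL]
      have h3 : z.re / R * (c * R + r * L R) = z.re / R * (δ + r) := by rw [hR]
      have h4 : z.re / R * (c * R) = c * z.re := by field_simp
      have h5 : z.re / R < 1 := (div_lt_one hRpos).2 hlt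
      have h6 := mul_le_mul_of_nonneg_left hconv hr.le
      nlinarith
    -- Subtracting the equations for z and R. Because Re z ≥ R, the factor e^{-R w} splits off and
    -- the rest is controlled by `norm_cexp_sub_one_le_of_re_nonpos`; hence c |z - R| ≤ r D |z - R|,
    -- which is impossible unless z = R.
    have hdiff : (c : ℂ) * (z - R) =
        r * ∫ w : ℝ, (Complex.exp (-(R : ℂ) * w) - Complex.exp (-z * w)) ∂ν := by
      rw [integral_sub (integrable_cexp_neg_mul hpos (by simpa using hR0))
        (integrable_cexp_neg_mul hpos hz.le), integral_cexp_neg_ofReal]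
      have h1 : (c : ℂ) * R + r * ((L R : ℝ) : ℂ) = δ + r := by exact_mod_cast hR
      change (c : ℂ) * (z - R) = r * (((L R : ℝ) : ℂ) - _)
      linear_combination hzeq - h1
    have hbd : ‖∫ w : ℝ, (Complex.exp (-(R : ℂ) * w) - Complex.exp (-z * w)) ∂ν‖ ≤
        ‖z - R‖ * D := by
      rw [hD, ← integral_const_mul]
      refine norm_integral_le_of_norm_le (hmint.const_mul _) ?_
      filter_upwards [hpos] with w hw
      have h1 : Complex.exp (-(R : ℂ) * w) - Complex.exp (-z * w) =
          -(Complex.exp (-(R : ℂ) * w) * (Complex.exp (-(z - R) * w) - 1)) := by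
        rw [mul_sub, ← Complex.exp_add]
        ring_nf
      have h2 : ‖Complex.exp (-(z - R) * w) - 1‖ ≤ ‖-(z - R) * (w : ℂ)‖ :=
        norm_cexp_sub_one_le_of_re_nonpos (by simp; nlinarith)
      rw [norm_mul, norm_neg, Complex.norm_real, Real.norm_of_nonneg hw.le] at h2
      rw [h1, norm_neg, norm_mul, Complex.norm_exp]
      have h3 : (-(R : ℂ) * w).re = -R * w := by simp
      rw [h3]
      nlinarith [Real.exp_pos (-R * w)]
    have hn := congrArg norm hdiff
    rw [norm_mul, norm_mul, Complex.norm_real, Complex.norm_real, Real.norm_of_nonneg hc.le,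
      Real.norm_of_nonneg hr.le] at hn
    by_contra hne
    have hp : 0 < ‖z - R‖ := norm_pos_iff.2 (sub_ne_zero.2 hne)
    have := mul_le_mul_of_nonneg_left hbd hr.le
    nlinarith
  · rintro rfl
    rw [integral_cexp_neg_ofReal]
    exact_mod_cast hR

end

/-! ### Sample paths between consecutive arrivals. -/

/-- The `n`-th arrival time, with the convention that the arrival of index `0` happens at time
`0`. -/
noncomputable def epoch (ξ : ℕ → ℝ) (n : ℕ) : ℝ := ∑ i ∈ Finset.range n, ξ i

/-- The surplus immediately after the `n`-th arrival. -/
noncomputable def surplusAtEpoch (c u : ℝ) (ξ W : ℕ → ℝ) (n : ℕ) : ℝ :=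
  u - c * epoch ξ n + ∑ i ∈ Finset.range n, W i

lemma epoch_succ (ξ : ℕ → ℝ) (n : ℕ) : epoch ξ (n + 1) = epoch ξ n + ξ n := by
  simp [epoch, Finset.sum_range_succ]

lemma surplusAtEpoch_succ (c u : ℝ) (ξ W : ℕ → ℝ) (n : ℕ) :
    surplusAtEpoch c u ξ W (n + 1) = surplusAtEpoch c u ξ W n - c * ξ n + W n := by
  simp [surplusAtEpoch, epoch_succ, Finset.sum_range_succ]
  ring

/-- The surplus stays nonnegative up to (and immediately before) the `n`-th arrival. -/
def AliveUntil (c u : ℝ) (ξ W : ℕ → ℝ) (n : ℕ) : Prop :=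
  ∀ i < n, c * ξ i ≤ surplusAtEpoch c u ξ W i

/-- The contribution to the surplus before ruin at time `T` of the event of exactly `n` arrivals
up to time `T`. -/
noncomputable def surplusBetweenEpochs (c u : ℝ) (ξ W : ℕ → ℝ) (T : ℝ) (n : ℕ) : ℝ :=
  open Classical in
  if AliveUntil c u ξ W n ∧ epoch ξ n ≤ T ∧ T < epoch ξ (n + 1) then
    max (surplusAtEpoch c u ξ W n - c * (T - epoch ξ n)) 0 else 0

lemma strictMono_epoch {ξ : ℕ → ℝ} (hξ : ∀ i, 0 < ξ i) : StrictMono (epoch ξ) :=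
  strictMono_nat_of_lt_succ fun n => by
    rw [epoch_succ]
    linarith [hξ n]

lemma epoch_nonneg {ξ : ℕ → ℝ} (hξ : ∀ i, 0 < ξ i) (n : ℕ) : 0 ≤ epoch ξ n :=
  Finset.sum_nonneg fun i _ => (hξ i).le

/-- If the epochs are unbounded, every nonnegative time lies between two consecutive epochs. -/
lemma exists_epoch_le_lt {ξ : ℕ → ℝ} {T : ℝ} (hT : 0 ≤ T) (hub : ∃ n, T < epoch ξ n) :
    ∃ N, epoch ξ N ≤ T ∧ T < epoch ξ (N + 1) := by
  classical
  obtain ⟨m, hm⟩ : ∃ m, Nat.find hub = m + 1 := by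
    refine Nat.exists_eq_succ_of_ne_zero fun h0 => ?_
    have := Nat.find_spec hub
    rw [h0] at this
    simp [epoch] at this
    linarith
  refine ⟨m, ?_, ?_⟩
  · by_contra! hlt
    have := Nat.find_min' hub hlt
    omega
  · have := Nat.find_spec hub
    rwa [hm] at this

section

variable {Ω : Type*} {ξ W : ℕ → Ω → ℝ} {ω : Ω} {c u s : ℝ}

/-- Index shift: `arrivalTime` at j is `epoch` at j + 1, so the arrivals counted are exactly those
with j < k. -/
lemma arrivalCount_eq (hξ : ∀ i, 0 < ξ i ω) {k : ℕ} (h1 : epoch (ξ · ω) k ≤ s)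
    (h2 : s < epoch (ξ · ω) (k + 1)) : arrivalCount ξ s ω = k := by
  have hset : {j : ℕ | arrivalTime ξ j ω ≤ s} = Finset.range k := by
    ext j
    change epoch (ξ · ω) (j + 1) ≤ s ↔ _
    have hm := strictMono_epoch hξ
    simp only [Finset.coe_range, Set.mem_Iio]
    constructor
    · intro h
      have := hm.lt_iff_lt.1 (h.trans_lt h2)
      omega
    · intro h
      exact (hm.monotone (show j + 1 ≤ k by omega)).trans h1
  rw [arrivalCount, hset, Set.ncard_coe_finset, Finset.card_range]

lemma minerSurplus_eq (hξ : ∀ i, 0 < ξ i ω) {k : ℕ} (h1 : epoch (ξ · ω) k ≤ s)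
    (h2 : s < epoch (ξ · ω) (k + 1)) :
    minerSurplus c ξ W u s ω =
      surplusAtEpoch c u (ξ · ω) (W · ω) k - c * (s - epoch (ξ · ω) k) := by
  rw [minerSurplus, arrivalCount_eq hξ h1 h2, surplusAtEpoch]
  ring

lemma ruinTime_le {X : ℝ → Ω → ℝ} (hs : 0 ≤ s) (hX : X s ω < 0) : ruinTime X ω ≤ (s : EReal) :=
  sInf_le ⟨s, hs, hX, rfl⟩

/-- If ruin does not occur before the `N`-th epoch, and the surplus at the later time `T` before
the next epoch is positive, then ruin occurs strictly after `T`. -/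
lemma lt_ruinTime (hξ : ∀ i, 0 < ξ i ω) (hc : 0 < c) {T : ℝ} {N : ℕ}
    (h1 : epoch (ξ · ω) N ≤ T) (h2 : T < epoch (ξ · ω) (N + 1))
    (halive : AliveUntil c u (ξ · ω) (W · ω) N)
    (hpos : 0 < surplusAtEpoch c u (ξ · ω) (W · ω) N - c * (T - epoch (ξ · ω) N)) :
    (T : EReal) < ruinTime (minerSurplus c ξ W u) ω := by
  set x := surplusAtEpoch c u (ξ · ω) (W · ω) N - c * (T - epoch (ξ · ω) N) with hx
  -- T + x / c is where the path would reach 0 without a further reward. No time before b has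
  -- negative surplus, and T < b yields the strict inequality even though the infimum need not be
  -- attained.
  set b := min (epoch (ξ · ω) (N + 1)) (T + x / c) with hb
  have hTb : T < b := lt_min h2 (by linarith [div_pos hpos hc])
  refine (EReal.coe_lt_coe_iff.2 hTb).trans_le (le_sInf ?_)
  rintro _ ⟨s, hs, hneg, rfl⟩
  rw [EReal.coe_le_coe_iff]
  by_contra! hlt
  have hsN : s < epoch (ξ · ω) (N + 1) := hlt.trans_le (min_le_left _ _)
  obtain ⟨k, hk1, hk2⟩ := exists_epoch_le_lt hs ⟨_, hsN⟩
  rw [minerSurplus_eq hξ hk1 hk2] at hneg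
  have hkN : k < N + 1 := (strictMono_epoch hξ).lt_iff_lt.1 (hk1.trans_lt hsN)
  rcases (Nat.lt_succ_iff.1 hkN).eq_or_lt with rfl | hk
  · have h3 : s < T + x / c := hlt.trans_le (min_le_right _ _)
    have h4 : c * (s - T) < x := by
      have := mul_lt_mul_of_pos_left (show s - T < x / c by linarith) hc
      rwa [mul_div_cancel₀ _ hc.ne'] at this
    linarith
  · have h3 := halive k hk
    rw [epoch_succ] at hk2
    have h4 : c * (s - epoch (ξ · ω) k) ≤ c * ξ k ω :=
      mul_le_mul_of_nonneg_left (by linarith) hc.le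
    linarith

/-- If survival fails in the i-th gap, the linear descent crosses 0 strictly before the next
arrival, so a time with negative surplus can be chosen inside the gap. -/
lemma ruinTime_le_of_not_aliveUntil (hξ : ∀ i, 0 < ξ i ω) (hc : 0 < c) {T : ℝ} {N : ℕ}
    (h1 : epoch (ξ · ω) N ≤ T) (halive : ¬ AliveUntil c u (ξ · ω) (W · ω) N) :
    ruinTime (minerSurplus c ξ W u) ω ≤ (T : EReal) := by
  simp only [AliveUntil, not_forall, not_le] at halive
  obtain ⟨i, hi, hlt⟩ := halive
  set x := surplusAtEpoch c u (ξ · ω) (W · ω) i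
  obtain ⟨r, hr1, hr2⟩ : ∃ r, max (x / c) 0 < r ∧ r < ξ i ω :=
    exists_between (max_lt ((div_lt_iff₀' hc).2 hlt) (hξ i))
  have hr0 : 0 < r := (le_max_right _ _).trans_lt hr1
  have hxr : x < c * r := (div_lt_iff₀' hc).1 ((le_max_left _ _).trans_lt hr1)
  have hs2 : epoch (ξ · ω) i + r < epoch (ξ · ω) (i + 1) := by
    rw [epoch_succ]
    linarith
  have hs0 := epoch_nonneg hξ i
  refine (ruinTime_le (s := epoch (ξ · ω) i + r) (by linarith) ?_).trans
    (EReal.coe_le_coe_iff.2 ?_)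
  · rw [minerSurplus_eq hξ (by linarith) hs2]
    change x - _ < 0
    ring_nf
    linarith
  · exact (hs2.le.trans ((strictMono_epoch hξ).monotone hi)).trans h1

/-- The surplus before ruin is the sum of the contributions of the numbers of arrivals. -/
theorem hasSum_surplusBetweenEpochs (hξ : ∀ i, 0 < ξ i ω) (hc : 0 < c) {T : Ω → ℝ}
    (hT : 0 ≤ T ω) (hub : ∃ n, T ω < epoch (ξ · ω) n) :
    HasSum (surplusBetweenEpochs c u (ξ · ω) (W · ω) (T ω))
      (surplusBeforeRuin (minerSurplus c ξ W u) T ω) := by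
  obtain ⟨N, h1, h2⟩ := exists_epoch_le_lt hT hub
  have hne : ∀ k, k ≠ N → surplusBetweenEpochs c u (ξ · ω) (W · ω) (T ω) k = 0 := by
    intro k hk
    rw [surplusBetweenEpochs, if_neg]
    rintro ⟨-, h3, h4⟩
    have h5 := (strictMono_epoch hξ).lt_iff_lt.1 (h3.trans_lt h2)
    have h6 := (strictMono_epoch hξ).lt_iff_lt.1 (h1.trans_lt h4)
    omega
  have heq : surplusBeforeRuin (minerSurplus c ξ W u) T ω =
      surplusBetweenEpochs c u (ξ · ω) (W · ω) (T ω) N := by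
    rw [surplusBetweenEpochs, surplusBeforeRuin]
    by_cases halive : AliveUntil c u (ξ · ω) (W · ω) N
    · rw [if_pos ⟨halive, h1, h2⟩]
      -- The truncation at 0 encodes ruin after the N-th epoch. When the surplus at T is exactly 0,
      -- both sides vanish whether or not ruin is later than T.
      rcases lt_trichotomy
        (surplusAtEpoch c u (ξ · ω) (W · ω) N - c * (T ω - epoch (ξ · ω) N)) 0 with h | h | h
      · rw [max_eq_right h.le, Set.indicator_of_notMem]
        exact (ruinTime_le hT (by rwa [minerSurplus_eq hξ h1 h2])).not_gt
      · rw [Set.indicator_apply, minerSurplus_eq hξ h1 h2]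
        simp [h]
      · rw [max_eq_left h.le, Set.indicator_of_mem, minerSurplus_eq hξ h1 h2]
        exact lt_ruinTime hξ hc h1 h2 halive h
    · rw [if_neg (fun h => halive h.1), Set.indicator_of_notMem]
      exact (ruinTime_le_of_not_aliveUntil hξ hc h1 halive).not_gt
  rw [heq]
  exact hasSum_single N hne

end

/-! ### The renewal equation and exponential integrals. -/

/-- The solution `B (e^{-R x} - 1) + x` of the renewal equation. -/
noncomputable def surplusValue (B R x : ℝ) : ℝ := B * Real.exp (-R * x) + x - B

lemma surplusValue_zero (B R : ℝ) : surplusValue B R 0 = 0 := by simp [surplusValue]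

/-- The renewal equation satisfied by the expected surplus before ruin: the first summand is the
contribution of an expiration of the horizon before the first arrival, the second one that of an
arrival before the horizon. -/
lemma surplusValue_eq_integral_add {c r δ R B L m x : ℝ} (hc : c ≠ 0) (hR : c * R + r * L = δ + r)
    (hB : δ * B = c - r * m) :
    surplusValue B R x =
      (∫ v in (0 : ℝ)..(x / c), δ * Real.exp (-(δ + r) * v) * (x - c * v)) +
      ∫ v in (0 : ℝ)..(x / c), r * Real.exp (-(δ + r) * v) *
        (B * Real.exp (-R * (x - c * v)) * L + (x - c * v) + m - B) := by
  rw [← intervalIntegral.integral_add (Continuous.intervalIntegrable (by fun_prop) _ _)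
    (Continuous.intervalIntegrable (by fun_prop) _ _)]
  -- An explicit primitive of the combined integrand: the negative of the discounted value along the
  -- descending path. At v = x / c it vanishes, at v = 0 it is minus the left-hand side.
  have hd : ∀ v : ℝ, HasDerivAt
      (fun v => -(Real.exp (-(δ + r) * v) * surplusValue B R (x - c * v)))
      (δ * Real.exp (-(δ + r) * v) * (x - c * v) + r * Real.exp (-(δ + r) * v) *
        (B * Real.exp (-R * (x - c * v)) * L + (x - c * v) + m - B)) v := by
    intro v
    have h1 : HasDerivAt (fun v => Real.exp (-(δ + r) * v))
        (Real.exp (-(δ + r) * v) * (-(δ + r) * 1)) v :=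
      ((hasDerivAt_id v).const_mul _).exp
    have h2 : HasDerivAt (fun v => x - c * v) (-(c * 1)) v :=
      ((hasDerivAt_id v).const_mul c).const_sub x
    have h3 : HasDerivAt (fun v => surplusValue B R (x - c * v))
        (B * (Real.exp (-R * (x - c * v)) * (-R * -(c * 1))) + -(c * 1)) v :=
      ((((h2.const_mul (-R)).exp).const_mul B).add h2).sub_const B
    refine (h1.mul h3).neg.congr_deriv ?_
    simp only [surplusValue]
    linear_combination (-(Real.exp (-(δ + r) * v) * B * Real.exp (-R * (x - c * v)))) * hR -
      Real.exp (-(δ + r) * v) * hB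
  rw [intervalIntegral.integral_eq_sub_of_hasDerivAt (fun v _ => hd v)
    (Continuous.intervalIntegrable (by fun_prop) _ _), mul_div_cancel₀ _ hc]
  simp [surplusValue_zero]

lemma setIntegral_Ioi_ite_le {c x : ℝ} (hc : 0 < c) (hx : 0 ≤ x) (g : ℝ → ℝ) :
    ∫ v in Set.Ioi 0, (if c * v ≤ x then g v else 0) = ∫ v in (0 : ℝ)..(x / c), g v := by
  rw [intervalIntegral.integral_of_le (by positivity), ← integral_indicator measurableSet_Ioi,
    ← integral_indicator measurableSet_Ioc]
  congr 1
  ext v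
  simp only [Set.indicator_apply, Set.mem_Ioi, Set.mem_Ioc, ← ite_and, le_div_iff₀' hc]

lemma setIntegral_Ioi_comp_sub (s : ℝ) (g : ℝ → ℝ) :
    ∫ v in Set.Ioi s, g (v - s) = ∫ v in Set.Ioi 0, g v := by
  rw [← integral_indicator measurableSet_Ioi, ← integral_indicator measurableSet_Ioi,
    ← integral_sub_right_eq_self ((Set.Ioi 0).indicator g) s]
  congr 1
  ext v
  simp [Set.indicator_apply]

lemma integral_expMeasure_ite_lt {r v : ℝ} (hr : 0 < r) (hv : 0 ≤ v) (b : ℝ) :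
    ∫ w, (if v < w then b else 0) ∂expMeasure r = b * Real.exp (-r * v) := by
  rw [integral_expMeasure hr]
  have h1 : ∀ w : ℝ, r * Real.exp (-r * w) * (if v < w then b else 0) =
      (Set.Ioi v).indicator (fun w => r * b * Real.exp (-r * w)) w := fun w => by
    by_cases h : v < w <;> simp [h]
    ring
  simp_rw [h1]
  rw [setIntegral_indicator measurableSet_Ioi, Set.inter_eq_right.2 (Set.Ioi_subset_Ioi hv),
    integral_const_mul, integral_exp_mul_Ioi (by linarith)]
  field_simp

/-- The lack of memory of the exponential distribution. -/
lemma integral_expMeasure_ite_le {δ s : ℝ} (hδ : 0 < δ) (hs : 0 ≤ s) (g : ℝ → ℝ) :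
    ∫ w, (if s ≤ w then g (w - s) else 0) ∂expMeasure δ =
      Real.exp (-δ * s) * ∫ w, g w ∂expMeasure δ := by
  rw [integral_expMeasure hδ, integral_expMeasure hδ, ← integral_const_mul,
    ← setIntegral_Ioi_comp_sub s
      (fun w => Real.exp (-δ * s) * (δ * Real.exp (-δ * w) * g w)), ← Set.inter_eq_right.2 (Set.Ioi_subset_Ioi hs),
    ← setIntegral_indicator measurableSet_Ioi]
  refine integral_congr_ae ?_
  -- The indicator on the left includes w = s and the half-line does not; this point is null.
  filter_upwards [Measure.ae_ne _ s] with w hw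
  have h1 : Real.exp (-δ * w) = Real.exp (-δ * s) * Real.exp (-δ * (w - s)) := by
    rw [← Real.exp_add]
    ring_nf
  rcases lt_or_gt_of_ne hw with h | h
  · simp [h.not_ge, h.le]
  · simp only [h.le, if_true, Set.indicator_of_mem (show w ∈ Set.Ioi s from h)]
    rw [h1]
    ring

/-- The contribution of an expiration of the horizon before the next arrival. -/
lemma integral_expMeasure_max {c δ r x : ℝ} (hc : 0 < c) (hδ : 0 < δ) (hx : 0 ≤ x) :
    ∫ v, max (x - c * v) 0 * Real.exp (-r * v) ∂expMeasure δ =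
      ∫ v in (0 : ℝ)..(x / c), δ * Real.exp (-(δ + r) * v) * (x - c * v) := by
  rw [integral_expMeasure hδ, ← setIntegral_Ioi_ite_le hc hx]
  congr 1
  ext v
  have h1 : Real.exp (-(δ + r) * v) = Real.exp (-δ * v) * Real.exp (-r * v) := by
    rw [← Real.exp_add]
    ring_nf
  split_ifs with h
  · rw [max_eq_left (by linarith), h1]
    ring
  · rw [max_eq_right (by linarith)]
    ring

/-- The contribution of an arrival before the horizon. -/
lemma integral_expMeasure_ite_mul {c δ r x : ℝ} (hc : 0 < c) (hr : 0 < r) (hx : 0 ≤ x)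
    (H : ℝ → ℝ) :
    ∫ v, (if c * v ≤ x then Real.exp (-δ * v) * H (x - c * v) else 0) ∂expMeasure r =
      ∫ v in (0 : ℝ)..(x / c), r * Real.exp (-(δ + r) * v) * H (x - c * v) := by
  rw [integral_expMeasure hr, ← setIntegral_Ioi_ite_le hc hx]
  congr 1
  ext v
  have h1 : Real.exp (-(δ + r) * v) = Real.exp (-δ * v) * Real.exp (-r * v) := by
    rw [← Real.exp_add]
    ring_nf
  split_ifs with h
  · rw [h1]
    ring
  · ring

/-! ### Freezing, independence of blocks, and the state at an arrival. -/

/-- Integration of a function of two independent random variables with the first one frozen. -/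
lemma integral_freeze_of_indepFun {Ω β γ : Type*} [MeasurableSpace Ω] {P : Measure Ω}
    [IsProbabilityMeasure P] [MeasurableSpace β] [MeasurableSpace γ]
    {Z : Ω → β} {Y : Ω → γ} {ρ : Measure γ} (hZ : Measurable Z) (hY : Measurable Y)
    (hlaw : P.map Y = ρ) (hind : IndepFun Z Y P) {g : β × γ → ℝ} (hg : Measurable g)
    (hint : Integrable (fun ω => g (Z ω, Y ω)) P) {ψ : Ω → ℝ}
    (hψ : ∀ᵐ ω ∂P, ∫ y, g (Z ω, y) ∂ρ = ψ ω) :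
    Integrable ψ P ∧ ∫ ω, g (Z ω, Y ω) ∂P = ∫ ω, ψ ω ∂P := by
  subst hlaw
  have : IsProbabilityMeasure (P.map Y) := Measure.isProbabilityMeasure_map hY.aemeasurable
  have : IsProbabilityMeasure (P.map Z) := Measure.isProbabilityMeasure_map hZ.aemeasurable
  have hmap := (indepFun_iff_map_prod_eq_prod_map_map hZ.aemeasurable hY.aemeasurable).1 hind
  have hint' : Integrable g ((P.map Z).prod (P.map Y)) := by
    rw [← hmap, integrable_map_measure hg.aestronglyMeasurable (hZ.prodMk hY).aemeasurable]
    exact hint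
  have h1 := hint'.integral_prod_left
  have h2 := (integrable_map_measure h1.aestronglyMeasurable hZ.aemeasurable).1 h1
  refine ⟨h2.congr hψ, ?_⟩
  rw [← integral_congr_ae hψ]
  have h3 : ∫ ω, g (Z ω, Y ω) ∂P = ∫ q, g q ∂((P.map Z).prod (P.map Y)) := by
    rw [← hmap, integral_map (hZ.prodMk hY).aemeasurable hg.aestronglyMeasurable]
  rw [h3, integral_prod _ hint', integral_map hZ.aemeasurable h1.aestronglyMeasurable]

/-- The σ-algebra generated by the members of a family with indices in a set. -/
abbrev sigmaOf {Ω ι : Type*} (f : ι → Ω → ℝ) (S : Set ι) : MeasurableSpace Ω :=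
  ⨆ i ∈ S, MeasurableSpace.comap (f i) inferInstance

lemma measurable_sigmaOf {Ω ι : Type*} (f : ι → Ω → ℝ) {S : Set ι} {i : ι} (hi : i ∈ S) :
    Measurable[sigmaOf f S] (f i) :=
  Measurable.mono (comap_measurable (f i))
    (le_iSup₂ (f := fun i (_ : i ∈ S) => MeasurableSpace.comap (f i) inferInstance) i hi) le_rfl

/-- This reduces each independence used below to disjointness of two sets of indices. -/
lemma indepFun_of_measurable_sigmaOf {Ω ι β γ : Type*} [MeasurableSpace Ω] {P : Measure Ω}
    {mβ : MeasurableSpace β}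
    {mγ : MeasurableSpace γ} {f : ι → Ω → ℝ} (hf : ∀ i, Measurable (f i))
    (hind : iIndepFun f P) {S S' : Set ι} (hS : Disjoint S S') {Z : Ω → β} {Y : Ω → γ}
    (hZ : Measurable[sigmaOf f S] Z) (hY : Measurable[sigmaOf f S'] Y) : IndepFun Z Y P := by
  rw [IndepFun_iff_Indep]
  have h := indep_iSup_of_disjoint (fun i => (hf i).comap_le) hind.iIndep hS
  exact indep_of_indep_of_le_left (indep_of_indep_of_le_right h hY.comap_le) hZ.comap_le

section

variable {Ω : Type*} {ξ W : ℕ → Ω → ℝ} {n : ℕ}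

lemma measurable_epoch [MeasurableSpace Ω] (hξ : ∀ i < n, Measurable (ξ i)) :
    Measurable fun ω => epoch (ξ · ω) n :=
  Finset.measurable_fun_sum _ fun i hi => hξ i (Finset.mem_range.1 hi)

lemma measurable_surplusAtEpoch [MeasurableSpace Ω] (c u : ℝ) (hξ : ∀ i < n, Measurable (ξ i))
    (hW : ∀ i < n, Measurable (W i)) :
    Measurable fun ω => surplusAtEpoch c u (ξ · ω) (W · ω) n :=
  (((measurable_epoch hξ).const_mul c).const_sub u).add
    (Finset.measurable_fun_sum _ fun i hi => hW i (Finset.mem_range.1 hi))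

lemma measurableSet_aliveUntil [MeasurableSpace Ω] (c u : ℝ) (hξ : ∀ i < n, Measurable (ξ i))
    (hW : ∀ i < n, Measurable (W i)) :
    MeasurableSet {ω | AliveUntil c u (ξ · ω) (W · ω) n} := by
  have : {ω | AliveUntil c u (ξ · ω) (W · ω) n} =
      ⋂ i, ⋂ (_ : i < n), {ω | c * ξ i ω ≤ surplusAtEpoch c u (ξ · ω) (W · ω) i} := by
    ext ω
    simp [AliveUntil]
  rw [this]
  exact MeasurableSet.iInter fun i => MeasurableSet.iInter fun hi =>
    measurableSet_le ((hξ i hi).const_mul c) (measurable_surplusAtEpoch c u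
      (fun j hj => hξ j (hj.trans hi)) (fun j hj => hW j (hj.trans hi)))

/-- The indicator of survival until the `n`-th arrival, the time of this arrival and the surplus
immediately after it. -/
noncomputable def epochState (c u : ℝ) (ξ W : ℕ → Ω → ℝ) (n : ℕ) (ω : Ω) : ℝ × ℝ × ℝ :=
  ({ω | AliveUntil c u (ξ · ω) (W · ω) n}.indicator 1 ω, epoch (ξ · ω) n,
    surplusAtEpoch c u (ξ · ω) (W · ω) n)

lemma measurable_epochState [MeasurableSpace Ω] (c u : ℝ) (hξ : ∀ i < n, Measurable (ξ i))
    (hW : ∀ i < n, Measurable (W i)) : Measurable (epochState c u ξ W n) :=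
  (measurable_one.indicator (measurableSet_aliveUntil c u hξ hW)).prodMk
    ((measurable_epoch hξ).prodMk (measurable_surplusAtEpoch c u hξ hW))

variable {c u : ℝ} {ω : Ω}

lemma epochState_fst_of_alive (h : AliveUntil c u (ξ · ω) (W · ω) n) :
    (epochState c u ξ W n ω).1 = 1 :=
  Set.indicator_of_mem (s := {ω | AliveUntil c u (ξ · ω) (W · ω) n}) h _

lemma epochState_fst_of_not_alive (h : ¬ AliveUntil c u (ξ · ω) (W · ω) n) :
    (epochState c u ξ W n ω).1 = 0 :=
  Set.indicator_of_notMem (s := {ω | AliveUntil c u (ξ · ω) (W · ω) n}) h _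

lemma aliveUntil_succ {ξ W : ℕ → ℝ} :
    AliveUntil c u ξ W (n + 1) ↔ AliveUntil c u ξ W n ∧ c * ξ n ≤ surplusAtEpoch c u ξ W n :=
  Nat.forall_lt_succ_right

lemma AliveUntil.surplusAtEpoch_nonneg {ξ W : ℕ → ℝ} (h : AliveUntil c u ξ W n) (hu : 0 ≤ u)
    (hW : ∀ i, 0 < W i) : 0 ≤ surplusAtEpoch c u ξ W n := by
  cases n with
  | zero => simpa [surplusAtEpoch, epoch] using hu
  | succ n =>
    rw [surplusAtEpoch_succ]
    linarith [hW n, (aliveUntil_succ.1 h).2]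

lemma surplusAtEpoch_le {ξ W : ℕ → ℝ} (hc : 0 ≤ c) (hξ : ∀ i, 0 < ξ i) :
    surplusAtEpoch c u ξ W n ≤ u + ∑ i ∈ Finset.range n, W i := by
  have := mul_nonneg hc (epoch_nonneg hξ n)
  rw [surplusAtEpoch]
  linarith

end

/-! ### The probabilistic model. -/

/-- The ingredients of the surplus process: independent families of interarrival times, which are
exponential with rate `r`, of rewards with law `ν`, and an independent exponential horizon with
rate `δ`. -/
structure IsMinerModel {Ω : Type*} [MeasurableSpace Ω] (P : Measure Ω) (r δ : ℝ) (ν : Measure ℝ)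
    (ξ W : ℕ → Ω → ℝ) (T : Ω → ℝ) : Prop where
  rate_pos : 0 < r
  horizon_pos : 0 < δ
  reward_pos : ∀ᵐ w ∂ν, 0 < w
  reward_integrable : Integrable (fun w => w) ν
  measurable_interarrival : ∀ k, Measurable (ξ k)
  measurable_reward : ∀ k, Measurable (W k)
  measurable_horizon : Measurable T
  law_interarrival : ∀ k, P.map (ξ k) = expMeasure r
  law_reward : ∀ k, P.map (W k) = ν
  law_horizon : P.map T = expMeasure δ
  indep : iIndepFun (Sum.elim ξ (Sum.elim W (fun _ : Unit => T))) P

namespace IsMinerModel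

variable {Ω : Type*} [MeasurableSpace Ω] {P : Measure Ω} {r δ : ℝ} {ν : Measure ℝ}
  {ξ W : ℕ → Ω → ℝ} {T : Ω → ℝ}

/-- The joint family of interarrival times, rewards and the horizon. -/
abbrev family (_ : IsMinerModel P r δ ν ξ W T) : ℕ ⊕ ℕ ⊕ Unit → Ω → ℝ :=
  Sum.elim ξ (Sum.elim W (fun _ : Unit => T))

lemma measurable_family (hM : IsMinerModel P r δ ν ξ W T) (i : ℕ ⊕ ℕ ⊕ Unit) :
    Measurable (hM.family i) := by
  rcases i with i | i | i
  · exact hM.measurable_interarrival i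
  · exact hM.measurable_reward i
  · exact hM.measurable_horizon

/-- The indices of the interarrival times and rewards up to the `n`-th arrival. -/
def pastIndices (n : ℕ) : Set (ℕ ⊕ ℕ ⊕ Unit) :=
  {i | (∃ k < n, i = Sum.inl k) ∨ ∃ k < n, i = Sum.inr (Sum.inl k)}

lemma measurable_epochState_sigmaOf (hM : IsMinerModel P r δ ν ξ W T) (c u : ℝ) (n : ℕ)
    {S : Set (ℕ ⊕ ℕ ⊕ Unit)} (hS : pastIndices n ⊆ S) :
    Measurable[sigmaOf hM.family S] (epochState c u ξ W n) :=
  @measurable_epochState Ω ξ W n (sigmaOf hM.family S) c u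
    (fun k hk => measurable_sigmaOf hM.family (i := Sum.inl k) (hS (Or.inl ⟨k, hk, rfl⟩)))
    (fun k hk => measurable_sigmaOf hM.family (i := Sum.inr (Sum.inl k))
      (hS (Or.inr ⟨k, hk, rfl⟩)))

/-- The state at the n-th epoch involves only indices below n, so the variables with index n are
still fresh. -/
lemma indepFun_epochState_interarrival_reward (hM : IsMinerModel P r δ ν ξ W T) (c u : ℝ)
    (n : ℕ) : IndepFun (fun ω => (epochState c u ξ W n ω, ξ n ω)) (W n) P := by
  refine indepFun_of_measurable_sigmaOf hM.measurable_family hM.indep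
    (S := pastIndices n ∪ {Sum.inl n}) (S' := {Sum.inr (Sum.inl n)}) ?_
    (Measurable.prodMk (hM.measurable_epochState_sigmaOf c u n Set.subset_union_left)
      (measurable_sigmaOf hM.family (i := Sum.inl n) (Or.inr rfl)))
    (measurable_sigmaOf hM.family (i := Sum.inr (Sum.inl n)) rfl)
  simp [pastIndices]

lemma indepFun_epochState_interarrival (hM : IsMinerModel P r δ ν ξ W T) (c u : ℝ)
    (n : ℕ) : IndepFun (epochState c u ξ W n) (ξ n) P := by
  refine indepFun_of_measurable_sigmaOf hM.measurable_family hM.indep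
    (S := pastIndices n) (S' := {Sum.inl n}) ?_
    (hM.measurable_epochState_sigmaOf c u n subset_rfl)
    (measurable_sigmaOf hM.family (i := Sum.inl n) rfl)
  simp [pastIndices]

lemma indepFun_epochState_horizon_interarrival (hM : IsMinerModel P r δ ν ξ W T) (c u : ℝ)
    (n : ℕ) : IndepFun (fun ω => (epochState c u ξ W n ω, T ω)) (ξ n) P := by
  refine indepFun_of_measurable_sigmaOf hM.measurable_family hM.indep
    (S := pastIndices n ∪ {Sum.inr (Sum.inr ())}) (S' := {Sum.inl n}) ?_
    (Measurable.prodMk (hM.measurable_epochState_sigmaOf c u n Set.subset_union_left)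
      (measurable_sigmaOf hM.family (i := Sum.inr (Sum.inr ())) (Or.inr rfl)))
    (measurable_sigmaOf hM.family (i := Sum.inl n) rfl)
  simp [pastIndices]

lemma indepFun_epochState_horizon (hM : IsMinerModel P r δ ν ξ W T) (c u : ℝ)
    (n : ℕ) : IndepFun (epochState c u ξ W n) T P := by
  refine indepFun_of_measurable_sigmaOf hM.measurable_family hM.indep
    (S := pastIndices n) (S' := {Sum.inr (Sum.inr ())}) ?_
    (hM.measurable_epochState_sigmaOf c u n subset_rfl)
    (measurable_sigmaOf hM.family (i := Sum.inr (Sum.inr ())) rfl)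
  simp [pastIndices]

lemma indepFun_epoch_sum_reward (hM : IsMinerModel P r δ ν ξ W T) (n : ℕ) :
    IndepFun (fun ω => epoch (ξ · ω) n) (fun ω => ∑ i ∈ Finset.range n, W i ω) P := by
  refine indepFun_of_measurable_sigmaOf hM.measurable_family hM.indep
    (S := Set.range Sum.inl) (S' := Set.range (fun k => Sum.inr (Sum.inl k))) ?_
    (@measurable_epoch Ω ξ n (sigmaOf hM.family _) fun k _ =>
      measurable_sigmaOf hM.family (i := Sum.inl k) ⟨k, rfl⟩)
    (Finset.measurable_fun_sum (m := sigmaOf hM.family _) _ fun k _ =>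
      measurable_sigmaOf hM.family (i := Sum.inr (Sum.inl k)) ⟨k, rfl⟩)
  rw [Set.disjoint_left]
  rintro _ ⟨k, rfl⟩ ⟨l, hl⟩
  simp at hl

lemma ae_pos (hM : IsMinerModel P r δ ν ξ W T) :
    ∀ᵐ ω ∂P, (∀ i, 0 < ξ i ω) ∧ (∀ i, 0 < W i ω) ∧ 0 < T ω := by
  have h1 : ∀ᵐ ω ∂P, ∀ i, 0 < ξ i ω := ae_all_iff.2 fun i =>
    ae_of_ae_map (hM.measurable_interarrival i).aemeasurable (by
      rw [hM.law_interarrival]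
      exact ae_pos_expMeasure r)
  have h2 : ∀ᵐ ω ∂P, ∀ i, 0 < W i ω := ae_all_iff.2 fun i =>
    ae_of_ae_map (hM.measurable_reward i).aemeasurable (by
      rw [hM.law_reward]
      exact hM.reward_pos)
  have h3 : ∀ᵐ ω ∂P, 0 < T ω := ae_of_ae_map hM.measurable_horizon.aemeasurable (by
    rw [hM.law_horizon]
    exact ae_pos_expMeasure δ)
  filter_upwards [h1, h2, h3] with ω a b d using ⟨a, b, d⟩

lemma integrable_reward (hM : IsMinerModel P r δ ν ξ W T) (k : ℕ) : Integrable (W k) P := by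
  have h := hM.reward_integrable
  rw [← hM.law_reward k, integrable_map_measure (by fun_prop)
    (hM.measurable_reward k).aemeasurable] at h
  exact h

lemma integral_reward (hM : IsMinerModel P r δ ν ξ W T) (k : ℕ) :
    ∫ ω, W k ω ∂P = ∫ w, w ∂ν := by
  rw [← hM.law_reward k, integral_map (hM.measurable_reward k).aemeasurable (by fun_prop)]

lemma integrable_sum_reward (hM : IsMinerModel P r δ ν ξ W T) (n : ℕ) :
    Integrable (fun ω => ∑ i ∈ Finset.range n, W i ω) P :=
  integrable_finsetSum _ fun i _ => hM.integrable_reward i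

/-- Independence multiplies the transforms of the exponential gaps. Used with θ = 1 to exclude
accumulation of arrivals before the horizon, and with θ = δ for the decay of the remainder. -/
lemma integral_exp_neg_epoch (hM : IsMinerModel P r δ ν ξ W T) {θ : ℝ} (hθ : 0 < θ) (n : ℕ) :
    ∫ ω, Real.exp (-θ * epoch (ξ · ω) n) ∂P = (r / (θ + r)) ^ n := by
  have hind : iIndepFun ξ P := hM.indep.precomp (g := Sum.inl) Sum.inl_injective
  have h1 := hind.mgf_sum hM.measurable_interarrival (Finset.range n) (t := -θ)
  have h2 : ∀ k, mgf (ξ k) P (-θ) = r / (θ + r) := fun k => by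
    have hr := hM.rate_pos
    have h3 := integral_map (μ := P) (hM.measurable_interarrival k).aemeasurable
      (f := fun w => Real.exp (-θ * w)) (by fun_prop)
    rw [hM.law_interarrival k, integral_expMeasure hr] at h3
    rw [mgf, ← h3]
    have h4 : ∀ w : ℝ, r * Real.exp (-r * w) * Real.exp (-θ * w) =
        r * Real.exp (-(θ + r) * w) := fun w => by
      rw [mul_assoc, ← Real.exp_add]
      ring_nf
    simp_rw [h4]
    rw [integral_const_mul, integral_exp_mul_Ioi (by linarith)]
    have : θ + r ≠ 0 := by positivity
    rw [mul_zero, Real.exp_zero, neg_div_neg_eq, mul_one_div]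
  simp only [h2, Finset.prod_const, Finset.card_range] at h1
  rw [← h1, mgf]
  simp [epoch]

lemma integrable_exp_neg_epoch [IsFiniteMeasure P] (hM : IsMinerModel P r δ ν ξ W T) {θ : ℝ}
    (hθ : 0 < θ) (n : ℕ) : Integrable (fun ω => Real.exp (-θ * epoch (ξ · ω) n)) P := by
  refine Integrable.of_bound (((measurable_epoch fun i _ =>
    hM.measurable_interarrival i).const_mul _).exp).aestronglyMeasurable 1 ?_
  filter_upwards [hM.ae_pos] with ω ⟨hξ, _, _⟩
  rw [Real.norm_eq_abs, Real.abs_exp, Real.exp_le_one_iff]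
  nlinarith [epoch_nonneg hξ n]

/-- Almost surely, the horizon is reached after finitely many arrivals. -/
lemma ae_exists_lt_epoch [IsFiniteMeasure P] (hM : IsMinerModel P r δ ν ξ W T) :
    ∀ᵐ ω ∂P, ∃ n, T ω < epoch (ξ · ω) n := by
  have hr := hM.rate_pos
  have hlim : Filter.Tendsto (fun n => ∫ ω, Real.exp (-1 * epoch (ξ · ω) n) ∂P) Filter.atTop
      (nhds 0) := by
    simp_rw [hM.integral_exp_neg_epoch one_pos]
    exact tendsto_pow_atTop_nhds_zero_of_lt_one (by positivity)
      ((div_lt_one (by positivity)).2 (by linarith))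
  set E : Set Ω := {ω | ∀ n, epoch (ξ · ω) n ≤ T ω} with hE
  have hEm : MeasurableSet E := by
    rw [hE, Set.ofPred_forall]
    exact MeasurableSet.iInter fun n => measurableSet_le
      (measurable_epoch fun i _ => hM.measurable_interarrival i) hM.measurable_horizon
  -- f lies below e^{-S_n} for every n, so its integral is 0; as f is positive on E, the set E is
  -- null.
  set f : Ω → ℝ := E.indicator (fun ω => Real.exp (-T ω)) with hf
  have hf0 : ∀ ω, 0 ≤ f ω := fun ω => Set.indicator_nonneg (fun _ _ => (Real.exp_pos _).le) ω
  have hle : ∀ n ω, f ω ≤ Real.exp (-1 * epoch (ξ · ω) n) := fun n ω => by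
    by_cases h : ω ∈ E
    · rw [hf, Set.indicator_of_mem h, Real.exp_le_exp]
      linarith [h n]
    · rw [hf, Set.indicator_of_notMem h]
      exact (Real.exp_pos _).le
  have hfi : Integrable f P := by
    refine (hM.integrable_exp_neg_epoch one_pos 0).mono'
      (hM.measurable_horizon.neg.exp.indicator hEm).aestronglyMeasurable (ae_of_all _ fun ω => ?_)
    rw [Real.norm_of_nonneg (hf0 ω)]
    exact hle 0 ω
  have hint : ∫ ω, f ω ∂P = 0 := le_antisymm (ge_of_tendsto' hlim fun n =>
    integral_mono hfi (hM.integrable_exp_neg_epoch one_pos n) (hle n)) (integral_nonneg hf0)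
  filter_upwards [(integral_eq_zero_iff_of_nonneg hf0 hfi).1 hint] with ω hω
  by_contra! h
  rw [hf, Set.indicator_of_mem (show ω ∈ E from h)] at hω
  exact (Real.exp_pos _).ne' hω

end IsMinerModel

/-! ### Telescoping of the discounted value. -/

lemma abs_surplusValue_le {B R x : ℝ} (hR : 0 ≤ R) (hx : 0 ≤ x) :
    |surplusValue B R x| ≤ |B| + x := by
  have h0 := Real.exp_pos (-R * x)
  have h1 : Real.exp (-R * x) ≤ 1 := Real.exp_le_one_iff.2 (by nlinarith)
  have h2 : |B * (Real.exp (-R * x) - 1)| ≤ |B| := by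
    rw [abs_mul]
    exact mul_le_of_le_one_right (abs_nonneg _) (by rw [abs_le]; constructor <;> linarith)
  have h3 : surplusValue B R x = B * (Real.exp (-R * x) - 1) + x := by
    rw [surplusValue]
    ring
  rw [h3]
  exact (abs_add_le _ _).trans (add_le_add h2 (abs_of_nonneg hx).le)

@[fun_prop]
lemma measurable_surplusValue (B R : ℝ) : Measurable (surplusValue B R) := by
  unfold surplusValue
  fun_prop

namespace IsMinerModel

variable {Ω : Type*} [MeasurableSpace Ω] {P : Measure Ω} {r δ : ℝ}
  {ν : Measure ℝ} {ξ W : ℕ → Ω → ℝ} {T : Ω → ℝ} {c u : ℝ}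

lemma measurable_epochState' (hM : IsMinerModel P r δ ν ξ W T) (n : ℕ) :
    Measurable (epochState c u ξ W n) :=
  measurable_epochState c u (fun i _ => hM.measurable_interarrival i)
    (fun i _ => hM.measurable_reward i)

/-- Almost surely, the state at an epoch either indicates ruin, or its surplus is nonnegative and
bounded by the initial capital and the sum of the rewards. -/
lemma ae_epochState (hM : IsMinerModel P r δ ν ξ W T) (hc : 0 ≤ c) (hu : 0 ≤ u) (n : ℕ) :
    ∀ᵐ ω ∂P, 0 ≤ (epochState c u ξ W n ω).2.1 ∧ 0 ≤ u + ∑ i ∈ Finset.range n, W i ω ∧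
      ((epochState c u ξ W n ω).1 = 0 ∨ (epochState c u ξ W n ω).1 = 1 ∧
        0 ≤ (epochState c u ξ W n ω).2.2 ∧
        (epochState c u ξ W n ω).2.2 ≤ u + ∑ i ∈ Finset.range n, W i ω) := by
  filter_upwards [hM.ae_pos] with ω ⟨hξ, hW, _⟩
  refine ⟨epoch_nonneg hξ n, add_nonneg hu (Finset.sum_nonneg fun i _ => (hW i).le), ?_⟩
  by_cases h : AliveUntil c u (ξ · ω) (W · ω) n
  · exact Or.inr ⟨epochState_fst_of_alive h, h.surplusAtEpoch_nonneg hu hW,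
      surplusAtEpoch_le hc hξ⟩
  · exact Or.inl (epochState_fst_of_not_alive h)

/-- The candidate value after the `n`-th arrival, discounted and restricted to survival. -/
noncomputable def discountedValue (c u : ℝ) (ξ W : ℕ → Ω → ℝ) (δ B R : ℝ) (n : ℕ) (ω : Ω) : ℝ :=
  (epochState c u ξ W n ω).1 * Real.exp (-δ * (epochState c u ξ W n ω).2.1) *
    surplusValue B R (epochState c u ξ W n ω).2.2

lemma abs_discountedValue_le (hM : IsMinerModel P r δ ν ξ W T) (hc : 0 ≤ c) (hu : 0 ≤ u)
    {B R : ℝ} (hR : 0 ≤ R) (n : ℕ) :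
    ∀ᵐ ω ∂P, ‖discountedValue c u ξ W δ B R n ω‖ ≤
      Real.exp (-δ * epoch (ξ · ω) n) * (|B| + u + ∑ i ∈ Finset.range n, W i ω) := by
  filter_upwards [hM.ae_epochState hc hu n] with ω ⟨h1, h2, h3⟩
  have h0 : 0 ≤ Real.exp (-δ * epoch (ξ · ω) n) * (|B| + u + ∑ i ∈ Finset.range n, W i ω) :=
    mul_nonneg (Real.exp_pos _).le (by linarith [abs_nonneg B])
  rcases h3 with h | ⟨h, hx0, hx⟩
  · simpa [discountedValue, h] using h0
  · rw [discountedValue, h, one_mul, norm_mul, Real.norm_of_nonneg (Real.exp_pos _).le]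
    refine mul_le_mul_of_nonneg_left ?_ (Real.exp_pos _).le
    rw [Real.norm_eq_abs]
    linarith [abs_surplusValue_le (B := B) hR hx0]

variable [IsProbabilityMeasure P]

lemma integrable_surplusBetweenEpochs (hM : IsMinerModel P r δ ν ξ W T) (hc : 0 ≤ c)
    (hu : 0 ≤ u) (n : ℕ) :
    Integrable (fun ω => surplusBetweenEpochs c u (ξ · ω) (W · ω) (T ω) n) P := by
  have hm : ∀ k, Measurable fun ω => epoch (ξ · ω) k := fun k =>
    measurable_epoch fun i _ => hM.measurable_interarrival i
  have hX := measurable_surplusAtEpoch (n := n) c u (fun i _ => hM.measurable_interarrival i)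
    (fun i _ => hM.measurable_reward i)
  refine ((integrable_const u).add (hM.integrable_sum_reward n)).mono'
    (Measurable.aestronglyMeasurable ?_) ?_
  · unfold surplusBetweenEpochs
    refine Measurable.ite (MeasurableSet.inter (measurableSet_aliveUntil c u
      (fun i _ => hM.measurable_interarrival i) (fun i _ => hM.measurable_reward i))
      (MeasurableSet.inter (measurableSet_le (hm n) hM.measurable_horizon)
      (measurableSet_lt hM.measurable_horizon (hm (n + 1))))) ?_ measurable_const
    exact (hX.sub ((hM.measurable_horizon.sub (hm n)).const_mul c)).max measurable_const
  · filter_upwards [hM.ae_pos] with ω ⟨hξ, hW, _⟩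
    have h0 : 0 ≤ u + ∑ i ∈ Finset.range n, W i ω :=
      add_nonneg hu (Finset.sum_nonneg fun i _ => (hW i).le)
    rw [surplusBetweenEpochs]
    split_ifs with h
    · rw [Real.norm_of_nonneg (le_max_right _ _)]
      refine max_le ?_ h0
      have h1 := surplusAtEpoch_le (c := c) (u := u) (n := n) (W := (W · ω)) hc hξ
      have h2 : 0 ≤ c * (T ω - epoch (ξ · ω) n) := mul_nonneg hc (by linarith [h.2.1])
      simp only [Pi.add_apply]
      linarith
    · simpa using h0

lemma integrable_exp_mul_sum_reward (hM : IsMinerModel P r δ ν ξ W T) (b : ℝ) (n : ℕ) :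
    Integrable (fun ω => Real.exp (-δ * epoch (ξ · ω) n) *
      (b + ∑ i ∈ Finset.range n, W i ω)) P := by
  refine ((integrable_const b).add (hM.integrable_sum_reward n)).bdd_mul (c := 1)
    (hM.integrable_exp_neg_epoch hM.horizon_pos n).aestronglyMeasurable ?_
  filter_upwards [hM.ae_pos] with ω ⟨hξ, _, _⟩
  rw [Real.norm_eq_abs, Real.abs_exp, Real.exp_le_one_iff]
  nlinarith [epoch_nonneg hξ n, hM.horizon_pos]

lemma integrable_discountedValue (hM : IsMinerModel P r δ ν ξ W T) (hc : 0 ≤ c) (hu : 0 ≤ u)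
    {B R : ℝ} (hR : 0 ≤ R) (n : ℕ) : Integrable (discountedValue c u ξ W δ B R n) P := by
  refine (hM.integrable_exp_mul_sum_reward (|B| + u) n).mono' ?_
    (hM.abs_discountedValue_le hc hu hR n)
  have := hM.measurable_epochState' (c := c) (u := u) n
  exact ((this.fst.mul (this.snd.fst.const_mul _).exp).mul
    ((measurable_surplusValue B R).comp this.snd.snd)).aestronglyMeasurable

/-- The value grows at most linearly, and on survival the surplus is at most u plus the sum of n
rewards. Arrival times and rewards being independent, the expectation is bounded by q^n b + n q^n m
with q = r / (δ + r) < 1. -/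
lemma tendsto_integral_discountedValue (hM : IsMinerModel P r δ ν ξ W T) (hc : 0 ≤ c)
    (hu : 0 ≤ u) {B R : ℝ} (hR : 0 ≤ R) :
    Filter.Tendsto (fun n => ∫ ω, discountedValue c u ξ W δ B R n ω ∂P) Filter.atTop
      (nhds 0) := by
  have hr := hM.rate_pos
  have hδ := hM.horizon_pos
  set b := |B| + u
  set q := r / (δ + r)
  have hq0 : 0 ≤ q := by positivity
  have hq1 : q < 1 := (div_lt_one (by positivity)).2 (by linarith)
  have hval : ∀ n, ∫ ω, Real.exp (-δ * epoch (ξ · ω) n) *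
      (b + ∑ i ∈ Finset.range n, W i ω) ∂P = q ^ n * b + (n * q ^ n) * ∫ w, w ∂ν := fun n => by
    have hind : IndepFun (fun ω => Real.exp (-δ * epoch (ξ · ω) n))
        (fun ω => b + ∑ i ∈ Finset.range n, W i ω) P :=
      (hM.indepFun_epoch_sum_reward n).comp (φ := fun x => Real.exp (-δ * x))
        (ψ := fun x => b + x) (by fun_prop) (by fun_prop)
    rw [hind.integral_fun_mul_eq_mul_integral
      (hM.integrable_exp_neg_epoch hδ n).aestronglyMeasurable
      ((integrable_const b).add (hM.integrable_sum_reward n)).aestronglyMeasurable,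
      hM.integral_exp_neg_epoch hδ, integral_add (integrable_const b) (hM.integrable_sum_reward n),
      integral_finsetSum _ fun i _ => hM.integrable_reward i]
    simp only [hM.integral_reward]
    simp
    ring
  refine squeeze_zero_norm (fun n => (norm_integral_le_of_norm_le
    (hM.integrable_exp_mul_sum_reward b n) (hM.abs_discountedValue_le hc hu hR n)).trans_eq
      (hval n)) ?_
  simpa using ((tendsto_pow_atTop_nhds_zero_of_lt_one hq0 hq1).mul_const b).add
    ((tendsto_self_mul_const_pow_of_lt_one hq0 hq1).mul_const (∫ w, w ∂ν))

/-- The expected contribution of the event of exactly `n` arrivals before the horizon. -/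
lemma integral_surplusBetweenEpochs (hM : IsMinerModel P r δ ν ξ W T) (hc : 0 < c)
    (hu : 0 ≤ u) (n : ℕ) :
    Integrable (fun ω => (epochState c u ξ W n ω).1 *
      Real.exp (-δ * (epochState c u ξ W n ω).2.1) *
      (∫ v in (0 : ℝ)..((epochState c u ξ W n ω).2.2 / c), δ * Real.exp (-(δ + r) * v) *
        ((epochState c u ξ W n ω).2.2 - c * v))) P ∧
    ∫ ω, surplusBetweenEpochs c u (ξ · ω) (W · ω) (T ω) n ∂P =
      ∫ ω, (epochState c u ξ W n ω).1 * Real.exp (-δ * (epochState c u ξ W n ω).2.1) *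
      (∫ v in (0 : ℝ)..((epochState c u ξ W n ω).2.2 / c), δ * Real.exp (-(δ + r) * v) *
        ((epochState c u ξ W n ω).2.2 - c * v)) ∂P := by
  have hZ := hM.measurable_epochState' (c := c) (u := u) n
  -- Two freezings: integrating out the next gap yields the factor e^{-r (T - S_n)}, giving g';
  -- integrating out T then restarts the horizon at S_n by lack of memory, with factor e^{-δ S_n}.
  let g : ((ℝ × ℝ × ℝ) × ℝ) × ℝ → ℝ := fun q =>
    if q.1.1.2.1 ≤ q.1.2 then (if q.1.2 - q.1.1.2.1 < q.2 then
      q.1.1.1 * max (q.1.1.2.2 - c * (q.1.2 - q.1.1.2.1)) 0 else 0) else 0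
  have hg : Measurable g := by
    refine Measurable.ite (measurableSet_le (by fun_prop) (by fun_prop)) (Measurable.ite
      (measurableSet_lt (by fun_prop) (by fun_prop)) (by fun_prop) (by fun_prop)) (by fun_prop)
  let g' : (ℝ × ℝ × ℝ) × ℝ → ℝ := fun q =>
    if q.1.2.1 ≤ q.2 then q.1.1 * (max (q.1.2.2 - c * (q.2 - q.1.2.1)) 0 *
      Real.exp (-r * (q.2 - q.1.2.1))) else 0
  have hg' : Measurable g' :=
    Measurable.ite (measurableSet_le (by fun_prop) (by fun_prop)) (by fun_prop) (by fun_prop)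
  have heq : (fun ω => surplusBetweenEpochs c u (ξ · ω) (W · ω) (T ω) n) =
      fun ω => g ((epochState c u ξ W n ω, T ω), ξ n ω) := by
    ext ω
    simp only [surplusBetweenEpochs, g, ← ite_and, sub_lt_iff_lt_add']
    by_cases h : AliveUntil c u (ξ · ω) (W · ω) n
    · rw [epochState_fst_of_alive h]
      simp only [h, true_and, one_mul]
      refine if_congr ?_ rfl rfl
      rw [epoch_succ]
      rfl
    · simp [h, epochState_fst_of_not_alive h]
  have hint := hM.integrable_surplusBetweenEpochs hc.le hu n
  rw [heq] at hint ⊢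
  obtain ⟨hint1, h1⟩ := integral_freeze_of_indepFun
    (ψ := fun ω => g' (epochState c u ξ W n ω, T ω)) (hZ.prodMk hM.measurable_horizon)
    (hM.measurable_interarrival n) (hM.law_interarrival n)
    (hM.indepFun_epochState_horizon_interarrival c u n) hg hint (ae_of_all _ fun ω => by
      simp only [g, g']
      split_ifs with h
      · rw [integral_expMeasure_ite_lt hM.rate_pos (sub_nonneg.2 h)]
        ring
      · simp)
  rw [h1]
  refine integral_freeze_of_indepFun hZ hM.measurable_horizon hM.law_horizon
    (hM.indepFun_epochState_horizon c u n) hg' hint1 ?_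
  filter_upwards [hM.ae_epochState hc.le hu n] with ω ⟨hs, _, hax⟩
  simp only [g']
  rw [integral_expMeasure_ite_le hM.horizon_pos hs (fun v => (epochState c u ξ W n ω).1 *
    (max ((epochState c u ξ W n ω).2.2 - c * v) 0 * Real.exp (-r * v))), integral_const_mul]
  rcases hax with h | ⟨h, hx, -⟩
  · simp [h]
  · rw [integral_expMeasure_max hc hM.horizon_pos hx]
    ring

lemma integral_surplusValue_add (hM : IsMinerModel P r δ ν ξ W T) (B : ℝ) {R : ℝ} (hR : 0 ≤ R)
    (y : ℝ) : ∫ w, surplusValue B R (y + w) ∂ν =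
      B * Real.exp (-R * y) * (∫ w, Real.exp (-R * w) ∂ν) + y + (∫ w, w ∂ν) - B := by
  have : IsProbabilityMeasure ν := by
    rw [← hM.law_reward 0]
    exact Measure.isProbabilityMeasure_map (hM.measurable_reward 0).aemeasurable
  have h1 : ∀ w, surplusValue B R (y + w) =
      B * Real.exp (-R * y) * Real.exp (-R * w) + w + (y - B) := fun w => by
    rw [surplusValue, mul_add, Real.exp_add]
    ring
  have h2 := (integrable_exp_neg_mul hM.reward_pos hR).const_mul (B * Real.exp (-R * y))
  have h3 : Integrable (fun w => B * Real.exp (-R * y) * Real.exp (-R * w) + w) ν :=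
    h2.add hM.reward_integrable
  simp_rw [h1]
  rw [integral_add h3 (integrable_const _), integral_add h2 hM.reward_integrable, integral_const_mul]
  simp
  ring

/-- The expected discounted value after the next arrival. -/
lemma integral_discountedValue_succ (hM : IsMinerModel P r δ ν ξ W T) (hc : 0 < c)
    (hu : 0 ≤ u) {B R L m : ℝ} (hR : 0 ≤ R) (hL : ∫ w, Real.exp (-R * w) ∂ν = L)
    (hm : ∫ w, w ∂ν = m) (n : ℕ) :
    Integrable (fun ω => (epochState c u ξ W n ω).1 *
      Real.exp (-δ * (epochState c u ξ W n ω).2.1) *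
      (∫ v in (0 : ℝ)..((epochState c u ξ W n ω).2.2 / c), r * Real.exp (-(δ + r) * v) *
        (B * Real.exp (-R * ((epochState c u ξ W n ω).2.2 - c * v)) * L +
          ((epochState c u ξ W n ω).2.2 - c * v) + m - B))) P ∧
    ∫ ω, discountedValue c u ξ W δ B R (n + 1) ω ∂P =
      ∫ ω, (epochState c u ξ W n ω).1 * Real.exp (-δ * (epochState c u ξ W n ω).2.1) *
      (∫ v in (0 : ℝ)..((epochState c u ξ W n ω).2.2 / c), r * Real.exp (-(δ + r) * v) *
        (B * Real.exp (-R * ((epochState c u ξ W n ω).2.2 - c * v)) * L +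
          ((epochState c u ξ W n ω).2.2 - c * v) + m - B)) ∂P := by
  have hZ := hM.measurable_epochState' (c := c) (u := u) n
  let H : ℝ → ℝ := fun y => B * Real.exp (-R * y) * L + y + m - B
  have hH : Measurable H := by fun_prop
  -- Here the reward is integrated out first, turning v into H, and then the gap. The factor e^{-δ
  -- (S_n + ξ_n)} already encodes that the horizon exceeds the next arrival.
  let g : ((ℝ × ℝ × ℝ) × ℝ) × ℝ → ℝ := fun q =>
    if c * q.1.2 ≤ q.1.1.2.2 then q.1.1.1 * Real.exp (-δ * (q.1.1.2.1 + q.1.2)) *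
      surplusValue B R ((q.1.1.2.2 - c * q.1.2) + q.2) else 0
  have hg : Measurable g :=
    Measurable.ite (measurableSet_le (by fun_prop) (by fun_prop)) (by fun_prop) (by fun_prop)
  let g' : (ℝ × ℝ × ℝ) × ℝ → ℝ := fun q =>
    if c * q.2 ≤ q.1.2.2 then q.1.1 * Real.exp (-δ * (q.1.2.1 + q.2)) *
      H (q.1.2.2 - c * q.2) else 0
  have hg' : Measurable g' :=
    Measurable.ite (measurableSet_le (by fun_prop) (by fun_prop)) (by fun_prop) (by fun_prop)
  have heq : discountedValue c u ξ W δ B R (n + 1) =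
      fun ω => g ((epochState c u ξ W n ω, ξ n ω), W n ω) := by
    ext ω
    have hx : (epochState c u ξ W (n + 1) ω).2.2 =
      (epochState c u ξ W n ω).2.2 - c * ξ n ω + W n ω := surplusAtEpoch_succ _ _ _ _ _
    have hs : (epochState c u ξ W (n + 1) ω).2.1 = (epochState c u ξ W n ω).2.1 + ξ n ω :=
      epoch_succ _ _
    simp only [discountedValue, g, hx, hs]
    split_ifs with h2
    · by_cases h : AliveUntil c u (ξ · ω) (W · ω) n
      · rw [epochState_fst_of_alive h, epochState_fst_of_alive (aliveUntil_succ.2 ⟨h, h2⟩)]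
      · rw [epochState_fst_of_not_alive h,
          epochState_fst_of_not_alive (fun h' => h (aliveUntil_succ.1 h').1)]
    · rw [epochState_fst_of_not_alive (fun h' => h2 (aliveUntil_succ.1 h').2)]
      simp
  have hint := hM.integrable_discountedValue (B := B) hc.le hu hR (n + 1)
  rw [heq] at hint ⊢
  obtain ⟨hint1, h1⟩ := integral_freeze_of_indepFun
    (ψ := fun ω => g' (epochState c u ξ W n ω, ξ n ω))
    (hZ.prodMk (hM.measurable_interarrival n)) (hM.measurable_reward n) (hM.law_reward n)
    (hM.indepFun_epochState_interarrival_reward c u n) hg hint (ae_of_all _ fun ω => by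
      simp only [g, g']
      split_ifs with h
      · rw [integral_const_mul, hM.integral_surplusValue_add B hR, hL, hm]
      · simp)
  rw [h1]
  refine integral_freeze_of_indepFun hZ (hM.measurable_interarrival n) (hM.law_interarrival n)
    (hM.indepFun_epochState_interarrival c u n) hg' hint1 ?_
  filter_upwards [hM.ae_epochState hc.le hu n] with ω ⟨hs, _, hax⟩
  simp only [g']
  rcases hax with h | ⟨h, hx, -⟩
  · simp [h]
  · rw [← integral_expMeasure_ite_mul hc hM.rate_pos hx H, ← integral_const_mul]
    congr 1
    ext v
    rw [mul_ite, mul_zero, mul_add, Real.exp_add]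
    simp only [mul_assoc]

/-- The expected surplus before ruin at an independent exponential horizon. -/
theorem integral_surplusBeforeRuin (hM : IsMinerModel P r δ ν ξ W T) (hc : 0 < c) (hu : 0 ≤ u)
    {B R : ℝ} (hR : 0 ≤ R) (hroot : c * R + r * ∫ w, Real.exp (-R * w) ∂ν = δ + r)
    (hB : δ * B = c - r * ∫ w, w ∂ν) :
    Integrable (surplusBeforeRuin (minerSurplus c ξ W u) T) P ∧
      ∫ ω, surplusBeforeRuin (minerSurplus c ξ W u) T ω ∂P = surplusValue B R u := by
  set F : ℕ → Ω → ℝ := fun n ω => surplusBetweenEpochs c u (ξ · ω) (W · ω) (T ω) n with hF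
  have hFint : ∀ n, Integrable (F n) P := hM.integrable_surplusBetweenEpochs hc.le hu
  have hF0 : ∀ n ω, 0 ≤ F n ω := fun n ω => by
    simp only [hF, surplusBetweenEpochs]
    split_ifs
    · exact le_max_right _ _
    · exact le_rfl
  -- The renewal identity at the random surplus after the n-th arrival, multiplied by survival and
  -- discount.
  have hstep : ∀ n, ∫ ω, F n ω ∂P = ∫ ω, discountedValue c u ξ W δ B R n ω ∂P -
      ∫ ω, discountedValue c u ξ W δ B R (n + 1) ω ∂P := fun n => by
    obtain ⟨i1, e1⟩ := hM.integral_surplusBetweenEpochs hc hu n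
    obtain ⟨i2, e2⟩ := hM.integral_discountedValue_succ (B := B) hc hu hR rfl rfl n
    rw [hF, e1, e2, eq_sub_iff_add_eq, ← integral_add i1 i2]
    refine integral_congr_ae (ae_of_all _ fun ω => ?_)
    simp only [discountedValue]
    rw [← mul_add, ← surplusValue_eq_integral_add hc.ne' hroot hB]
  have hsum : HasSum (fun n => ∫ ω, F n ω ∂P) (surplusValue B R u) := by
    rw [hasSum_iff_tendsto_nat_of_nonneg fun n => integral_nonneg (hF0 n)]
    simp_rw [hstep, Finset.sum_range_sub']
    have h0 : ∫ ω, discountedValue c u ξ W δ B R 0 ω ∂P = surplusValue B R u := by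
      have : ∀ ω, discountedValue c u ξ W δ B R 0 ω = surplusValue B R u := fun ω => by
        rw [discountedValue, epochState_fst_of_alive (by simp [AliveUntil])]
        simp [epochState, epoch, surplusAtEpoch]
      simp [this]
    rw [h0]
    simpa using (hM.tendsto_integral_discountedValue hc.le hu hR).const_sub (surplusValue B R u)
  have hae : ∀ᵐ ω ∂P, HasSum (fun n => F n ω)
      (surplusBeforeRuin (minerSurplus c ξ W u) T ω) := by
    filter_upwards [hM.ae_pos, hM.ae_exists_lt_epoch] with ω ⟨hξ, _, hT⟩ hub
    exact hasSum_surplusBetweenEpochs hξ hc hT.le hub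
  have hnorm : ∀ n, ∫ ω, ‖F n ω‖ ∂P = ∫ ω, F n ω ∂P := fun n => by
    simp only [Real.norm_of_nonneg (hF0 n _)]
  have htsum := hasSum_integral_of_summable_integral_norm hFint (by
    simp_rw [hnorm]
    exact hsum.summable)
  have hval : ∫ ω, surplusBeforeRuin (minerSurplus c ξ W u) T ω ∂P = surplusValue B R u := by
    rw [hsum.unique htsum]
    refine integral_congr_ae ?_
    filter_upwards [hae] with ω hω using hω.tsum_eq.symm
  refine ⟨?_, hval⟩
  have hmeas : AEStronglyMeasurable (surplusBeforeRuin (minerSurplus c ξ W u) T) P :=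
    aestronglyMeasurable_of_tendsto_ae Filter.atTop (f := fun N ω => ∑ n ∈ Finset.range N, F n ω)
      (fun N => (integrable_finsetSum _ fun n _ => hFint n).aestronglyMeasurable) (by
        filter_upwards [hae] with ω hω using hω.tendsto_sum_nat)
  refine ⟨hmeas, ?_⟩
  -- Nonnegativity of the terms makes the norm of the sum the sum itself, so monotone convergence
  -- gives a finite integral.
  have henorm : ∫⁻ ω, ‖surplusBeforeRuin (minerSurplus c ξ W u) T ω‖ₑ ∂P =
      ∑' n, ENNReal.ofReal (∫ ω, F n ω ∂P) := by
    simp_rw [ofReal_integral_eq_lintegral_ofReal (hFint _) (ae_of_all _ (hF0 _))]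
    rw [← lintegral_tsum fun n => (hFint n).aestronglyMeasurable.aemeasurable.ennreal_ofReal]
    refine lintegral_congr_ae ?_
    filter_upwards [hae] with ω hω
    rw [Real.enorm_of_nonneg (hω.nonneg fun n => hF0 n ω), ← hω.tsum_eq,
      ENNReal.ofReal_tsum_of_nonneg (fun n => hF0 n ω) hω.summable]
  rw [HasFiniteIntegral, henorm, ← ENNReal.ofReal_tsum_of_nonneg
    (fun n => integral_nonneg (hF0 n)) hsum.summable]
  exact ENNReal.ofReal_lt_top

end IsMinerModel

/-! ### Specialisation to combinations of exponentials. -/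

theorem theorem5p4 {Ω : Type*} [MeasurableSpace Ω] (P : Measure Ω) [IsProbabilityMeasure P]
    (c p μ t : ℝ) (hc : 0 < c) (hp : 0 < p) (hp1 : p < 1) (hμ : 0 < μ) (ht : 0 < t)
    {n : ℕ} (A α : Fin n → ℝ) (hA : IsCombExp A α)
    (ξ W : ℕ → Ω → ℝ) (T : Ω → ℝ)
    (hξm : ∀ k, Measurable (ξ k)) (hWm : ∀ k, Measurable (W k)) (hTm : Measurable T)
    (hξ : ∀ k, P.map (ξ k) = expMeasure (p * μ))
    (hW : ∀ k, P.map (W k) =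
      volume.withDensity (fun w => ENNReal.ofReal (combExpDensity A α w)))
    (hT : P.map T = expMeasure (1 / t))
    (hindep : iIndepFun (Sum.elim ξ (Sum.elim W (fun _ : Unit => T))) P) :
    ∃ R : ℝ, 0 < R ∧
      (∀ z : ℂ, 0 < z.re →
        ((c : ℂ) * z + p * μ * (∑ j, (A j : ℂ) * α j / (z + α j)) - (1 / t + p * μ) = 0 ↔
          z = (R : ℂ))) ∧
      ∀ u : ℝ, 0 < u →
        Integrable (surplusBeforeRuin (minerSurplus c ξ W u) T) P ∧
        expectedSurplus P c ξ W T u =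
          t * (c - p * μ * (∑ j, A j / α j)) * Real.exp (-R * u) + u
            + t * (p * μ * (∑ j, A j / α j) - c) := by
  have hr : 0 < p * μ := mul_pos hp hμ
  have hδ : 0 < 1 / t := by positivity
  have hM : IsMinerModel P (p * μ) (1 / t) (combExpMeasure A α) ξ W T :=
    ⟨hr, hδ, ae_pos_combExpMeasure A α, integrable_id_combExpMeasure hA, hξm, hWm, hTm, hξ, hW,
      hT, hindep⟩
  -- Total mass one is read off from its being the law of a reward.
  have : IsProbabilityMeasure (combExpMeasure A α) := by
    rw [← hM.law_reward 0]
    exact Measure.isProbabilityMeasure_map (hWm 0).aemeasurable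
  obtain ⟨R, hR, hroot, huniq⟩ := exists_unique_lundberg_root hM.reward_pos
    hM.reward_integrable hc hr hδ
  refine ⟨R, hR, fun z hz => ?_, fun u hu => ?_⟩
  · rw [← huniq z hz, integral_cexp_combExpMeasure hA hz.le, sub_eq_zero]
    push_cast
    rfl
  -- This B solves δ B = c - r m for δ = 1 / t and m = ∑ A_j / α_j.
  · obtain ⟨hint, hval⟩ := hM.integral_surplusBeforeRuin (B := t * (c - p * μ * ∑ j, A j / α j))
      hc hu.le hR.le hroot (by
        rw [integral_id_combExpMeasure hA]
        field_simp)
    refine ⟨hint, hval.trans ?_⟩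
    rw [surplusValue]
    ring
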